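/- **Central Limit Theorem for the Sample Latent Correlation.** *Threshold model.* Let $Z=(Z_1,\dots,Z_d)\sim\varphi$ be a random vector in $\mathbb R^d$ whose coordinates have continuous CDFs $F_1,\dots,F_d$ with quantile functions $F_k^{-1}(p)=\inf\{x: p\le F_k(x)\}$, and let $\theta=(\theta_1,\dots,\theta_d)\sim\nu$ be a random vector in $(0,1)^d$ that is independent of $Z$. Put $$X_k=\mathbb I\big(Z_k\le F_k^{-1}(\theta_k)\big),\qquad U_k=\frac{X_k-\theta_k}{\sqrt{\theta_k(1-\theta_k)}},\qquad U_A=\frac1{|A|}\sum_{k\in A}U_k \quad (\emptyset\ne A\subseteq[d]),$$ $$\psi(j,k)=\mathbb E\left[\frac{(X_j-\theta_j)(X_k-\theta_k)}{\sqrt{\theta_j(1-\theta_j)\theta_k(1-\theta_k)}}\right],\qquad \Psi(A)=\frac1{|A|^2}\sum_{j,k\in A}\psi(j,k).$$ *Setting.* For each $n\ge1$ let $(\varphi_n,\nu_n)$ be a threshold model in dimension $d_n$; the dimension and both distributions may depend on $n$. Let $Z_1,\dots,Z_n\sim\varphi_n$ and $\theta_1,\dots,\theta_n\sim\nu_n$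 be independent random vectors, let $X_{ik}$, $U_{ik}$, $U_{iA}$ be formed as above from $(Z_i,\theta_i)$, and set $$\widehat\psi_n(j,A)=\frac1n\sum_{i=1}^nU_{ij}U_{iA},\qquad \widehat\sigma_n^2(j,A)=\frac1n\sum_{i=1}^nU_{ij}^2U_{iA}^2,\qquad \widehat\sigma_n(j,A)=\sqrt{\widehat\sigma_n^2(j,A)}.$$ *Theorem.* Fix $j$ (with $j\in[d_n]$ for all $n$), and for each $n$ let $A_n\subseteq[d_n]\setminus\{j\}$ be a nonempty index set with cardinality $m_n$. Assume that (i) for each $n$, $Z_j$ is independent of $\{Z_k:k\in A_n\}$ under $\varphi_n$; and (ii) as $n\to\infty$, $$\Psi(A_n)^{-2}\left(\frac1{m_n}\sum_{k\in A_n}\mathbb E\left[\theta_j^{-1}\theta_k^{-1}(1-\theta_j)^{-1}(1-\theta_k)^{-1}\right]\right)=o(n),$$ where $\Psi(A_n)$ and the expectations are taken under $(\varphi_n,\nu_n)$, and the left side is read as $+\infty$ if $\Psi(A_n)=0$ or if one of the expectations is infinite. Then $$\sqrt n\,\frac{\widehat\psi_n(j,A_n)}{\widehat\sigma_n(j,A_n)}\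 \xrightarrow{\ d\ }\ \mathcal N(0,1)\qquad\text{as } n\to\infty .$$ -/

import Mathlib

open MeasureTheory ProbabilityTheory Filter Topology
open scoped ENNReal

noncomputable section

/-- The quantile function `F⁻¹(p) = inf {x : p ≤ F x}` of a probability measure on the real line
with CDF `F`. For `p ∈ (0,1)` the set is nonempty and bounded below. -/
def quantile (μ : Measure ℝ) (p : ℝ) : ℝ := sInf {x : ℝ | p ≤ cdf μ x}

/-- A threshold model in dimension `d`: a law `φ` of the latent vector `Z`, all of whose
coordinates have continuous CDFs, and a law `ν` of the threshold vector `θ ∈ (0,1)^d`.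
The pair `(Z, θ)` has law `φ ⊗ ν`. -/
structure ThresholdModel (d : ℕ) where
  /-- the law of `Z` -/
  φ : Measure (Fin d → ℝ)
  /-- the law of `θ` -/
  ν : Measure (Fin d → ℝ)
  isProbabilityMeasure_φ : IsProbabilityMeasure φ
  isProbabilityMeasure_ν : IsProbabilityMeasure ν
  continuous_cdf : ∀ j, Continuous (cdf (φ.map (fun z => z j)))
  threshold_mem : ∀ᵐ t ∂ν, ∀ j, t j ∈ Set.Ioo (0 : ℝ) 1

namespace ThresholdModel

attribute [instance] isProbabilityMeasure_φ isProbabilityMeasure_ν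

variable {d : ℕ} (M : ThresholdModel d)

open scoped Classical in
/-- The observed binary variable `X_j = 𝟙(Z_j ≤ F_j⁻¹(θ_j))`, where `Z = z` and `θ = t`. -/
def X (z t : Fin d → ℝ) (j : Fin d) : ℝ :=
  if z j ≤ quantile (M.φ.map (fun w => w j)) (t j) then 1 else 0

/-- `U_j = (X_j - θ_j) / √(θ_j (1 - θ_j))`. -/
def U (z t : Fin d → ℝ) (j : Fin d) : ℝ :=
  (M.X z t j - t j) / √(t j * (1 - t j))

/-- `U_A`, the average of `U_k` over `k ∈ A`. -/
def UAvg (z t : Fin d → ℝ) (A : Finset (Fin d)) : ℝ :=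
  (1 / (A.card : ℝ)) * ∑ k ∈ A, M.U z t k

/-- The latent correlation
`ψ(j,k) = E[(X_j - θ_j)(X_k - θ_k) / √(θ_j (1 - θ_j) θ_k (1 - θ_k))]`. -/
def psi (j k : Fin d) : ℝ :=
  ∫ p : (Fin d → ℝ) × (Fin d → ℝ),
    ((M.X p.1 p.2 j - p.2 j) * (M.X p.1 p.2 k - p.2 k)) /
      √(p.2 j * (1 - p.2 j) * (p.2 k * (1 - p.2 k))) ∂(M.φ.prod M.ν)

/-- `Ψ(A)`, the average pairwise latent correlation between the variables in `A`. -/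
def Psi (A : Finset (Fin d)) : ℝ :=
  (1 / (A.card : ℝ) ^ 2) * ∑ j ∈ A, ∑ k ∈ A, M.psi j k

/-- The sample latent correlation `ψ̂_n(j,A) = n⁻¹ ∑_i U_{ij} U_{iA}` of the sample
`(z_i, t_i)`, `i = 1, …, n`. -/
def psiHat {n : ℕ} (z t : Fin n → Fin d → ℝ) (j : Fin d) (A : Finset (Fin d)) : ℝ :=
  (1 / (n : ℝ)) * ∑ i, M.U (z i) (t i) j * M.UAvg (z i) (t i) A

/-- The variance estimate `σ̂²_n(j,A) = n⁻¹ ∑_i U_{ij}² U_{iA}²`. -/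
def sigmaHatSq {n : ℕ} (z t : Fin n → Fin d → ℝ) (j : Fin d) (A : Finset (Fin d)) : ℝ :=
  (1 / (n : ℝ)) * ∑ i, (M.U (z i) (t i) j) ^ 2 * (M.UAvg (z i) (t i) A) ^ 2

/-- `σ̂_n(j,A)`. -/
def sigmaHat {n : ℕ} (z t : Fin n → Fin d → ℝ) (j : Fin d) (A : Finset (Fin d)) : ℝ :=
  √(M.sigmaHatSq z t j A)

/-- `E[θ_j⁻¹ θ_k⁻¹ (1 - θ_j)⁻¹ (1 - θ_k)⁻¹] ∈ [0, ∞]`; the integrand is positive. -/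
def thresholdMoment (j k : Fin d) : ℝ≥0∞ :=
  ∫⁻ t, ENNReal.ofReal ((t j)⁻¹ * (t k)⁻¹ * (1 - t j)⁻¹ * (1 - t k)⁻¹) ∂M.ν

/-- `Ψ(A)⁻² · (1/|A|) ∑_{k ∈ A} E[θ_j⁻¹ θ_k⁻¹ (1 - θ_j)⁻¹ (1 - θ_k)⁻¹]` for nonempty `A`, as an
element of `[0, ∞]`. It is finite only if `Ψ(A) ≠ 0` and all the expectations are finite
(every expectation is positive, so that `Ψ(A) = 0` gives the value `∞`). -/
def momentRatio (j : Fin d) (A : Finset (Fin d)) : ℝ≥0∞ :=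
  (ENNReal.ofReal (M.Psi A) ^ 2)⁻¹ * ((A.card : ℝ≥0∞)⁻¹ * ∑ k ∈ A, M.thresholdMoment j k)

end ThresholdModel

end

/-!
Conditionally on `θ`, the variables `U_j` and `U_A` are independent under (i), and `U_j` is
standardized. Hence `V = U_j U_A` is centered with variance `E U_A² = Ψ(A)`, and since
`E[U_k⁴ | θ] ≤ 1 / (θ_k (1 - θ_k))`, Jensen's inequality for the average `U_A` bounds
`E V⁴ / Ψ(A)²` by the quantity in (ii). With `V_i` the value of `V` on the `i`-th observation, the
statistic is `∑ V_i / √(∑ V_i²)`, because the factors `1 / n` cancel, and (ii) becomes Lyapunov's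
condition of order four. It gives a central limit theorem for `∑ V_i` through characteristic
functions and, by Chebyshev's inequality, a law of large numbers for `∑ V_i²`. Slutsky's theorem
combines the two; as it needs a common probability space, it is applied on the product of the
spaces of all rows.
-/

section CharFun

lemma norm_exp_mul_I_sub_taylor_le (x : ℝ) :
    ‖Complex.exp (x * Complex.I) - (1 + x * Complex.I - x ^ 2 / 2)‖ ≤ 4 * |x| ^ 3 := by
  rcases le_or_gt |x| 1 with hx | hx
  · have taylor := Complex.norm_exp_sub_sum_le_norm_mul_exp (x * Complex.I) 3
    have norm_arg : ‖(x * Complex.I : ℂ)‖ = |x| := by simp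
    have sum_eq : ∑ m ∈ Finset.range 3, (x * Complex.I) ^ m / (m.factorial : ℂ)
        = 1 + x * Complex.I - x ^ 2 / 2 := by
      simp only [Finset.sum_range_succ, Finset.sum_range_zero, Nat.factorial, mul_pow,
        Complex.I_sq]
      push_cast
      ring
    rw [sum_eq, norm_arg, mul_comm (|x| ^ 3)] at taylor
    refine taylor.trans ?_
    gcongr
    calc Real.exp |x| ≤ Real.exp 1 := Real.exp_le_exp.2 hx
      _ ≤ 4 := by linarith [Real.exp_one_lt_d9]
  · have norm_poly : ‖(1 + x * Complex.I - x ^ 2 / 2 : ℂ)‖ ≤ 1 + |x| + |x| ^ 2 / 2 := by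
      refine (norm_sub_le _ _).trans (add_le_add ((norm_add_le _ _).trans ?_) ?_) <;> simp
    refine (norm_sub_le _ _).trans ?_
    rw [Complex.norm_exp_ofReal_mul_I]
    nlinarith [mul_pos (sub_pos.2 hx) (sub_pos.2 hx), pow_pos (sub_pos.2 hx) 3]

lemma abs_exp_neg_sub_one_sub_le {u : ℝ} (hu : 0 ≤ u) :
    |Real.exp (-u) - (1 - u)| ≤ u ^ 2 / 2 := by
  have lower : 1 - u ≤ Real.exp (-u) := Real.one_sub_le_exp_neg u
  have upper : Real.exp (-u) ≤ 1 - u + u ^ 2 / 2 := by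
    rw [Real.exp_neg]
    refine inv_le_of_inv_le₀ (by nlinarith [sq_nonneg (u - 1)]) ?_
    refine le_trans ?_ (Real.quadratic_le_exp_of_nonneg hu)
    rw [inv_le_iff_one_le_mul₀ (by nlinarith [sq_nonneg (u - 1)])]
    nlinarith [pow_nonneg hu 4]
  rw [abs_of_nonneg (by linarith)]
  linarith

lemma norm_prod_sub_prod_le {ι : Type*} (s : Finset ι) {a b : ι → ℂ}
    (ha : ∀ i ∈ s, ‖a i‖ ≤ 1) (hb : ∀ i ∈ s, ‖b i‖ ≤ 1) :
    ‖∏ i ∈ s, a i - ∏ i ∈ s, b i‖ ≤ ∑ i ∈ s, ‖a i - b i‖ := by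
  classical
  induction s using Finset.induction_on with
  | empty => simp
  | insert i s hi ih =>
    simp only [Finset.forall_mem_insert] at ha hb
    have telescope : a i * ∏ k ∈ s, a k - b i * ∏ k ∈ s, b k
        = (a i - b i) * ∏ k ∈ s, a k + b i * (∏ k ∈ s, a k - ∏ k ∈ s, b k) := by ring
    have norm_prod_le_one : ‖∏ k ∈ s, a k‖ ≤ 1 := by
      rw [norm_prod]
      exact Finset.prod_le_one (fun _ _ => norm_nonneg _) ha.2
    rw [Finset.prod_insert hi, Finset.prod_insert hi, Finset.sum_insert hi, telescope]
    refine (norm_add_le _ _).trans (add_le_add ?_ ?_)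
    · rw [norm_mul]
      exact mul_le_of_le_one_right (norm_nonneg _) norm_prod_le_one
    · rw [norm_mul]
      exact (mul_le_of_le_one_left (norm_nonneg _) hb.1).trans (ih ha.2 hb.2)

variable {Ω : Type*} [MeasurableSpace Ω] {P : Measure Ω}

lemma integral_mul_le_sqrt_mul_sqrt {f g : Ω → ℝ} (hf : MemLp f 2 P) (hg : MemLp g 2 P)
    (hf₀ : 0 ≤ f) (hg₀ : 0 ≤ g) :
    ∫ ω, f ω * g ω ∂P ≤ √(∫ ω, f ω ^ 2 ∂P) * √(∫ ω, g ω ^ 2 ∂P) := by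
  have := integral_mul_le_Lp_mul_Lq_of_nonneg Real.HolderConjugate.two_two (ae_of_all P hf₀)
    (ae_of_all P hg₀) (by simpa using hf) (by simpa using hg)
  simpa [Real.sqrt_eq_rpow] using this

lemma memLp_sq {Y : Ω → ℝ} (hY : MemLp Y 4 P) : MemLp (fun ω => Y ω ^ 2) 2 P := by
  have hm : AEStronglyMeasurable (fun ω => Y ω ^ 2) P := hY.aestronglyMeasurable.pow 2
  refine (memLp_two_iff_integrable_sq hm).2 ?_
  refine (hY.integrable_norm_pow (p := 4) (by norm_num)).congr (ae_of_all _ fun ω => ?_)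
  simp only [Real.norm_eq_abs, (by decide : Even 4).pow_abs]
  ring

lemma integral_abs_pow_three_le [IsFiniteMeasure P] {Y : Ω → ℝ} (hY : MemLp Y 4 P) :
    ∫ ω, |Y ω| ^ 3 ∂P ≤ √(∫ ω, Y ω ^ 2 ∂P) * √(∫ ω, Y ω ^ 4 ∂P) := by
  have cauchy := integral_mul_le_sqrt_mul_sqrt (f := fun ω => |Y ω|)
    (hY.mono_exponent (by norm_num)).abs (memLp_sq hY) (fun ω => abs_nonneg (Y ω))
    (fun ω => sq_nonneg (Y ω))
  have cube (ω : Ω) : |Y ω| ^ 3 = |Y ω| * Y ω ^ 2 := by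
    rw [← sq_abs (Y ω)]
    ring
  simpa only [cube, sq_abs, ← pow_mul] using cauchy

lemma sq_integral_sq_le [IsProbabilityMeasure P] {Y : Ω → ℝ} (hY : MemLp Y 4 P) :
    (∫ ω, Y ω ^ 2 ∂P) ^ 2 ≤ ∫ ω, Y ω ^ 4 ∂P := by
  have := variance_nonneg (fun ω => Y ω ^ 2) P
  rw [variance_eq_sub (memLp_sq hY)] at this
  simpa [← pow_mul] using this

lemma norm_integral_exp_mul_I_sub_le [IsProbabilityMeasure P] {Y : Ω → ℝ} (hY : MemLp Y 3 P)
    (hmean : ∫ ω, Y ω ∂P = 0) :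
    ‖∫ ω, Complex.exp (Y ω * Complex.I) ∂P - (1 - (∫ ω, Y ω ^ 2 ∂P : ℝ) / 2)‖
      ≤ 4 * ∫ ω, |Y ω| ^ 3 ∂P := by
  have int1 : Integrable Y P := hY.integrable (by norm_num)
  have int2 : Integrable (fun ω => Y ω ^ 2) P :=
    (hY.mono_exponent (by norm_num : (2 : ℝ≥0∞) ≤ 3)).integrable_sq
  have int3 : Integrable (fun ω => |Y ω| ^ 3) P := hY.integrable_norm_pow (by norm_num)
  have intExp : Integrable (fun ω => Complex.exp (Y ω * Complex.I)) P := by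
    have := int1.aemeasurable
    refine (integrable_const (1 : ℝ)).mono' (by fun_prop) (ae_of_all _ fun ω => ?_)
    rw [Complex.norm_exp_ofReal_mul_I]
  have taylor_eq (ω : Ω) : (1 + Y ω * Complex.I - Y ω ^ 2 / 2 : ℂ)
      = ((1 - Y ω ^ 2 / 2 : ℝ) : ℂ) + Y ω * Complex.I := by
    push_cast
    ring
  have intRe : Integrable (fun ω => 1 - Y ω ^ 2 / 2) P :=
    (integrable_const 1).sub (int2.div_const 2)
  have intReC : Integrable (fun ω => ((1 - Y ω ^ 2 / 2 : ℝ) : ℂ)) P := intRe.ofReal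
  have intIm : Integrable (fun ω => (Y ω : ℂ) * Complex.I) P := int1.ofReal.mul_const _
  have intTaylor : Integrable (fun ω => (1 + Y ω * Complex.I - Y ω ^ 2 / 2 : ℂ)) P := by
    simp only [taylor_eq]
    exact intReC.add intIm
  have integral_taylor : ∫ ω, (1 + Y ω * Complex.I - Y ω ^ 2 / 2 : ℂ) ∂P
      = (1 - (∫ ω, Y ω ^ 2 ∂P : ℝ) / 2 : ℂ) := by
    simp only [taylor_eq]
    rw [integral_add intReC intIm, integral_mul_const, integral_complex_ofReal,
      integral_complex_ofReal, hmean, integral_sub (integrable_const 1) (int2.div_const 2),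
      integral_div]
    simp
  rw [← integral_taylor, ← integral_sub intExp intTaylor, ← integral_const_mul]
  exact norm_integral_le_of_norm_le (int3.const_mul 4)
    (ae_of_all _ fun ω => norm_exp_mul_I_sub_taylor_le (Y ω))

lemma norm_charFun_map_sub_le [IsProbabilityMeasure P] {Y : Ω → ℝ} (hY : MemLp Y 3 P)
    (hmean : ∫ ω, Y ω ∂P = 0) (s : ℝ) :
    ‖charFun (P.map Y) s - (1 - (s ^ 2 * ∫ ω, Y ω ^ 2 ∂P : ℝ) / 2)‖
      ≤ 4 * (|s| ^ 3 * ∫ ω, |Y ω| ^ 3 ∂P) := by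
  have bound := norm_integral_exp_mul_I_sub_le (hY.const_mul s)
    (by rw [integral_const_mul, hmean, mul_zero])
  simp only [mul_pow, abs_mul, integral_const_mul] at bound
  rw [charFun_apply_real, integral_map hY.aemeasurable (by fun_prop)]
  simpa using bound

lemma norm_charFun_map_sub_exp_le [IsProbabilityMeasure P] {Y : Ω → ℝ} (hY : MemLp Y 4 P)
    (hmean : ∫ ω, Y ω ∂P = 0) (s : ℝ) :
    ‖charFun (P.map Y) s - Real.exp (-(s ^ 2 * (∫ ω, Y ω ^ 2 ∂P) / 2))‖
      ≤ 4 * |s| ^ 3 * (√(∫ ω, Y ω ^ 2 ∂P) * √(∫ ω, Y ω ^ 4 ∂P))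
        + s ^ 4 / 8 * ∫ ω, Y ω ^ 4 ∂P := by
  set v := ∫ ω, Y ω ^ 2 ∂P
  have : 0 ≤ v := integral_nonneg fun ω => sq_nonneg _
  have charFun_bound : ‖charFun (P.map Y) s - (1 - s ^ 2 * v / 2 : ℝ)‖
      ≤ 4 * |s| ^ 3 * (√v * √(∫ ω, Y ω ^ 4 ∂P)) := by
    have := norm_charFun_map_sub_le (hY.mono_exponent (by norm_num)) hmean s
    rw [mul_assoc]
    refine le_trans (by simpa using this) ?_
    gcongr
    exact integral_abs_pow_three_le hY
  have exp_bound : ‖((1 - s ^ 2 * v / 2 : ℝ) : ℂ) - Real.exp (-(s ^ 2 * v / 2))‖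
      ≤ s ^ 4 / 8 * ∫ ω, Y ω ^ 4 ∂P := by
    rw [← Complex.ofReal_sub, Complex.norm_real, Real.norm_eq_abs, abs_sub_comm]
    calc _ ≤ (s ^ 2 * v / 2) ^ 2 / 2 := abs_exp_neg_sub_one_sub_le (by positivity)
      _ = s ^ 4 / 8 * v ^ 2 := by ring
      _ ≤ _ := by gcongr; exact sq_integral_sq_le hY
  exact (norm_sub_le_norm_sub_add_norm_sub _ _ _).trans (add_le_add charFun_bound exp_bound)

variable {ι : Type*} [Fintype ι]

lemma norm_charFun_map_sum_sub_exp_le [IsProbabilityMeasure P] {Y : ι → Ω → ℝ}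
    (hY : ∀ i, MemLp (Y i) 4 P) (hmean : ∀ i, ∫ ω, Y i ω ∂P = 0) (hindep : iIndepFun Y P) (s : ℝ) :
    ‖charFun (P.map fun ω => ∑ i, Y i ω) s
        - Real.exp (-(s ^ 2 * (∑ i, ∫ ω, Y i ω ^ 2 ∂P) / 2))‖
      ≤ 4 * |s| ^ 3 * (√(∑ i, ∫ ω, Y i ω ^ 2 ∂P) * √(∑ i, ∫ ω, Y i ω ^ 4 ∂P))
        + s ^ 4 / 8 * ∑ i, ∫ ω, Y i ω ^ 4 ∂P := by
  have hm (i : ι) : AEMeasurable (Y i) P := (hY i).aemeasurable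
  have exp_eq : (Real.exp (-(s ^ 2 * (∑ i, ∫ ω, Y i ω ^ 2 ∂P) / 2)) : ℂ)
      = ∏ i, (Real.exp (-(s ^ 2 * (∫ ω, Y i ω ^ 2 ∂P) / 2)) : ℂ) := by
    rw [← Complex.ofReal_prod, ← Real.exp_sum, Finset.sum_neg_distrib, Finset.mul_sum,
      Finset.sum_div]
  have norm_charFun_le (i : ι) : ‖charFun (P.map (Y i)) s‖ ≤ 1 := by
    have := Measure.isProbabilityMeasure_map (hm i)
    exact norm_charFun_le_one s
  have norm_exp_le (i : ι) : ‖(Real.exp (-(s ^ 2 * (∫ ω, Y i ω ^ 2 ∂P) / 2)) : ℂ)‖ ≤ 1 := by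
    have : 0 ≤ ∫ ω, Y i ω ^ 2 ∂P := integral_nonneg fun ω => sq_nonneg _
    rw [Complex.norm_real, Real.norm_eq_abs, Real.abs_exp, Real.exp_le_one_iff]
    exact neg_nonpos.2 (by positivity)
  rw [hindep.charFun_map_fun_sum_eq_prod hm, Finset.prod_apply, exp_eq]
  refine (norm_prod_sub_prod_le _ (fun i _ => norm_charFun_le i) fun i _ => norm_exp_le i).trans ?_
  refine (Finset.sum_le_sum fun i _ => norm_charFun_map_sub_exp_le (hY i) (hmean i) s).trans ?_
  rw [Finset.sum_add_distrib, ← Finset.mul_sum, ← Finset.mul_sum]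
  gcongr
  exact Real.sum_sqrt_mul_sqrt_le _ (fun i => integral_nonneg fun ω => sq_nonneg _)
    fun i => integral_nonneg fun ω => by positivity

lemma norm_charFun_map_sum_normalized_sub_exp_le [IsProbabilityMeasure P] {Y : ι → Ω → ℝ}
    (hY : ∀ i, MemLp (Y i) 4 P) (hmean : ∀ i, ∫ ω, Y i ω ∂P = 0) (hindep : iIndepFun Y P)
    (hpos : 0 < ∑ i, ∫ ω, Y i ω ^ 2 ∂P) (t : ℝ) :
    ‖charFun (P.map fun ω => ∑ i, Y i ω) ((√(∑ i, ∫ ω, Y i ω ^ 2 ∂P))⁻¹ * t)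
        - Real.exp (-(t ^ 2 / 2))‖
      ≤ 4 * |t| ^ 3 * √((∑ i, ∫ ω, Y i ω ^ 4 ∂P) / (∑ i, ∫ ω, Y i ω ^ 2 ∂P) ^ 2)
        + t ^ 4 / 8 * ((∑ i, ∫ ω, Y i ω ^ 4 ∂P) / (∑ i, ∫ ω, Y i ω ^ 2 ∂P) ^ 2) := by
  have bound := norm_charFun_map_sum_sub_exp_le hY hmean hindep
    ((√(∑ i, ∫ ω, Y i ω ^ 2 ∂P))⁻¹ * t)
  set L := ∑ i, ∫ ω, Y i ω ^ 4 ∂P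
  obtain ⟨b, hb, hB⟩ : ∃ b > 0, ∑ i, ∫ ω, Y i ω ^ 2 ∂P = b ^ 2 :=
    ⟨_, Real.sqrt_pos.2 hpos, (Real.sq_sqrt hpos.le).symm⟩
  rw [hB, Real.sqrt_sq hb.le] at bound ⊢
  have exponent_eq : (b⁻¹ * t) ^ 2 * b ^ 2 / 2 = t ^ 2 / 2 := by field_simp
  have third_eq : |b⁻¹ * t| ^ 3 * (b * √L) = |t| ^ 3 * √(L / (b ^ 2) ^ 2) := by
    rw [Real.sqrt_div' _ (by positivity), Real.sqrt_sq (by positivity), abs_mul, abs_inv,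
      abs_of_pos hb]
    field_simp
  have fourth_eq : (b⁻¹ * t) ^ 4 * L = t ^ 4 * (L / (b ^ 2) ^ 2) := by field_simp
  rw [exponent_eq] at bound
  refine bound.trans_eq ?_
  linear_combination 4 * third_eq + fourth_eq / 8

lemma measure_le_dist_sum_sq_div_le [IsProbabilityMeasure P] {Y : ι → Ω → ℝ}
    (hY : ∀ i, MemLp (Y i) 4 P) (hindep : Pairwise fun i k => IndepFun (Y i) (Y k) P)
    (hpos : 0 < ∑ i, ∫ ω, Y i ω ^ 2 ∂P) {ε : ℝ} (hε : 0 < ε) :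
    P {ω | ε ≤ dist ((∑ i, Y i ω ^ 2) / ∑ i, ∫ ω, Y i ω ^ 2 ∂P) 1}
      ≤ ENNReal.ofReal
        ((∑ i, ∫ ω, Y i ω ^ 4 ∂P) / (∑ i, ∫ ω, Y i ω ^ 2 ∂P) ^ 2 / ε ^ 2) := by
  set B := ∑ i, ∫ ω, Y i ω ^ 2 ∂P
  have hL2 (i : ι) : MemLp (fun ω => Y i ω ^ 2) 2 P := memLp_sq (hY i)
  let S : Ω → ℝ := ∑ i, fun ω => Y i ω ^ 2
  have S_apply (ω : Ω) : S ω = ∑ i, Y i ω ^ 2 := Finset.sum_apply _ _ _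
  have integral_S : ∫ ω, S ω ∂P = B := by
    simp only [S_apply]
    exact integral_finsetSum _ fun i _ => (hL2 i).integrable one_le_two
  have variance_S_le : variance S P ≤ ∑ i, ∫ ω, Y i ω ^ 4 ∂P := by
    have hindep_sq : Set.Pairwise (Finset.univ : Finset ι)
        fun i k => IndepFun (fun ω => Y i ω ^ 2) (fun ω => Y k ω ^ 2) P := fun i _ k _ hik =>
      (hindep hik).comp (φ := fun x : ℝ => x ^ 2) (ψ := fun x : ℝ => x ^ 2)
        (by fun_prop) (by fun_prop)
    rw [IndepFun.variance_sum (fun i _ => hL2 i) hindep_sq]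
    gcongr with i
    simpa [← pow_mul] using variance_le_expectation_sq (hL2 i).1
  have event_eq : {ω | ε ≤ dist ((∑ i, Y i ω ^ 2) / B) 1}
      = {ω | B * ε ≤ |S ω - ∫ ω, S ω ∂P|} := by
    ext ω
    have : |S ω - B| = B * |S ω / B - 1| := by
      rw [← abs_of_pos hpos, ← abs_mul, abs_of_pos hpos, mul_sub, mul_div_cancel₀ _ hpos.ne',
        mul_one]
    simp only [Set.mem_ofPred_eq, Real.dist_eq, integral_S, this, ← S_apply,
      mul_le_mul_iff_right₀ hpos]
  rw [event_eq, div_div, ← mul_pow]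
  refine (meas_ge_le_variance_div_sq (memLp_finsetSum' _ fun i _ => hL2 i) (by positivity)).trans
    (ENNReal.ofReal_le_ofReal ?_)
  gcongr

end CharFun

section Slutsky

variable {ι Ω' : Type*} {Ω : ι → Type*} [∀ n, MeasurableSpace (Ω n)] [MeasurableSpace Ω']
  {P : ∀ n, Measure (Ω n)} {l : Filter ι} {E : Type*}

/-- Convergence in probability to a constant, for random variables on varying probability
spaces; Mathlib's `TendstoInMeasure` lives on a single space. -/
def TendstoInProbability [PseudoMetricSpace E] (Y : ∀ n, Ω n → E) (l : Filter ι) (c : E)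
    (P : ∀ n, Measure (Ω n)) : Prop :=
  ∀ ε > 0, Tendsto (fun n => P n {ω | ε ≤ dist (Y n ω) c}) l (𝓝 0)

lemma TendstoInProbability.comp_continuousAt {F : Type*} [PseudoMetricSpace E]
    [PseudoMetricSpace F] {Y : ∀ n, Ω n → E} {c : E} (hY : TendstoInProbability Y l c P)
    {g : E → F} (hg : ContinuousAt g c) :
    TendstoInProbability (fun n ω => g (Y n ω)) l (g c) P := by
  intro ε hε
  obtain ⟨δ, hδ, hgδ⟩ := Metric.continuousAt_iff.1 hg ε hε
  refine tendsto_of_tendsto_of_tendsto_of_le_of_le tendsto_const_nhds (hY δ hδ)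
    (fun n => zero_le) fun n => measure_mono fun ω hω => ?_
  by_contra hlt
  exact absurd hω (not_le.2 (hgδ (not_le.1 hlt)))

variable [∀ n, IsProbabilityMeasure (P n)] {P' : Measure Ω'} [IsProbabilityMeasure P']
  [MeasurableSpace E]

lemma aemeasurable_comp_eval_infinitePi {n : ι} {f : Ω n → E} (hf : AEMeasurable f (P n)) :
    AEMeasurable (fun ω : ∀ n, Ω n => f (ω n)) (Measure.infinitePi P) :=
  hf.comp_quasiMeasurePreserving (measurePreserving_eval_infinitePi P n).quasiMeasurePreserving

lemma map_comp_eval_infinitePi {n : ι} {f : Ω n → E} (hf : AEMeasurable f (P n)) :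
    (Measure.infinitePi P).map (fun ω => f (ω n)) = (P n).map f := by
  have hn := measurePreserving_eval_infinitePi P n
  have map_map := AEMeasurable.map_map_of_aemeasurable (f := Function.eval n) (g := f)
    (μ := Measure.infinitePi P) (by rwa [hn.map_eq]) hn.measurable.aemeasurable
  rw [hn.map_eq] at map_map
  exact map_map.symm

lemma tendstoInDistribution_infinitePi_iff [TopologicalSpace E] [OpensMeasurableSpace E]
    {X : ∀ n, Ω n → E} {T : Ω' → E} (hX : ∀ n, AEMeasurable (X n) (P n)) :
    TendstoInDistribution (fun n (ω : ∀ n, Ω n) => X n (ω n)) l T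
      (fun _ => Measure.infinitePi P) P' ↔ TendstoInDistribution X l T P P' := by
  constructor <;> intro h
  · refine ⟨hX, h.aemeasurable_limit, h.tendsto.congr fun n => Subtype.ext ?_⟩
    exact map_comp_eval_infinitePi (hX n)
  · refine ⟨fun n => aemeasurable_comp_eval_infinitePi (hX n), h.aemeasurable_limit,
      h.tendsto.congr fun n => Subtype.ext ?_⟩
    exact (map_comp_eval_infinitePi (hX n)).symm

lemma TendstoInProbability.tendstoInMeasure_infinitePi [PseudoMetricSpace E]
    [OpensMeasurableSpace E] {Y : ∀ n, Ω n → E} {c : E} (hYm : ∀ n, AEMeasurable (Y n) (P n))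
    (hY : TendstoInProbability Y l c P) :
    TendstoInMeasure (Measure.infinitePi P) (fun n ω => Y n (ω n)) l fun _ => c := by
  refine tendstoInMeasure_iff_dist.2 fun ε hε => (hY ε hε).congr fun n => ?_
  have hclosed : IsClosed {y | ε ≤ dist y c} := isClosed_le continuous_const (by fun_prop)
  have hnull : NullMeasurableSet {ω | ε ≤ dist (Y n ω) c} (P n) :=
    (hYm n).nullMeasurableSet_preimage hclosed.measurableSet
  exact ((measurePreserving_eval_infinitePi P n).measure_preimage hnull).symm

lemma tendstoInDistribution_congr_eventually [TopologicalSpace E] [OpensMeasurableSpace E]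
    {X Y : ∀ n, Ω n → E} {T : Ω' → E} (hX : TendstoInDistribution X l T P P')
    (hYm : ∀ n, AEMeasurable (Y n) (P n)) (hXY : ∀ᶠ n in l, X n =ᵐ[P n] Y n) :
    TendstoInDistribution Y l T P P' :=
  ⟨hYm, hX.aemeasurable_limit,
    hX.tendsto.congr' (hXY.mono fun _ hn => Subtype.ext (Measure.map_congr hn))⟩

lemma tendstoInDistribution_mul_of_tendstoInProbability_one [l.IsCountablyGenerated]
    {X Y : ∀ n, Ω n → ℝ} {T : Ω' → ℝ} (hX : TendstoInDistribution X l T P P')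
    (hYm : ∀ n, AEMeasurable (Y n) (P n)) (hY : TendstoInProbability Y l 1 P) :
    TendstoInDistribution (fun n ω => X n ω * Y n ω) l T P P' := by
  have hXm := hX.forall_aemeasurable
  have slutsky := ((tendstoInDistribution_infinitePi_iff hXm).2
    hX).continuous_comp_prodMk_of_tendstoInMeasure_const (g := fun p : ℝ × ℝ => p.1 * p.2)
    continuous_mul (hY.tendstoInMeasure_infinitePi hYm)
    fun n => aemeasurable_comp_eval_infinitePi (hYm n)
  simp only [mul_one] at slutsky
  exact (tendstoInDistribution_infinitePi_iff fun n => (hXm n).mul (hYm n)).1 slutsky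

end Slutsky

section LyapunovArray

variable {ι : ℕ → Type*} [∀ n, Fintype (ι n)] {Ω : ℕ → Type*} [∀ n, MeasurableSpace (Ω n)]

/-- A triangular array of centered random variables, independent within each row, that satisfies
Lyapunov's condition of order four. The rows are not normalized, and the moment hypotheses are
only imposed on all but finitely many rows. -/
structure IsLyapunovArray (Y : ∀ n, ι n → Ω n → ℝ) (P : ∀ n, Measure (Ω n)) : Prop where
  aemeasurable : ∀ n i, AEMeasurable (Y n i) (P n)
  iIndepFun : ∀ n, iIndepFun (Y n) (P n)
  memLp : ∀ᶠ n in atTop, ∀ i, MemLp (Y n i) 4 (P n)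
  integral_eq_zero : ∀ᶠ n in atTop, ∀ i, ∫ ω, Y n i ω ∂(P n) = 0
  sum_sq_pos : ∀ᶠ n in atTop, 0 < ∑ i, ∫ ω, Y n i ω ^ 2 ∂(P n)
  tendsto_ratio : Tendsto
    (fun n => (∑ i, ∫ ω, Y n i ω ^ 4 ∂(P n)) / (∑ i, ∫ ω, Y n i ω ^ 2 ∂(P n)) ^ 2) atTop (𝓝 0)

namespace IsLyapunovArray

variable {Y : ∀ n, ι n → Ω n → ℝ} {P : ∀ n, Measure (Ω n)}

section OfHasLaw

variable {E : ℕ → Type*} [∀ n, MeasurableSpace (E n)] {μ : ∀ n, Measure (E n)}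
  {V : ∀ n, E n → ℝ} {W : ∀ n, Fin n → Ω n → E n}

theorem of_hasLaw (hVm : ∀ n, Measurable (V n)) (hW : ∀ n i, HasLaw (W n i) (μ n) (P n))
    (hindep : ∀ n, ProbabilityTheory.iIndepFun (W n) (P n))
    (hV : ∀ᶠ n in atTop, MemLp (V n) 4 (μ n)) (hmean : ∀ n, ∫ x, V n x ∂(μ n) = 0)
    (hpos : ∀ᶠ n in atTop, 0 < ∫ x, V n x ^ 2 ∂(μ n))
    (hratio : Tendsto (fun n : ℕ => (∫ x, V n x ^ 4 ∂(μ n)) / (∫ x, V n x ^ 2 ∂(μ n)) ^ 2 / n)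
      atTop (𝓝 0)) :
    IsLyapunovArray (fun n (i : Fin n) ω => V n (W n i ω)) P := by
  have integral_pow (n : ℕ) (i : Fin n) (r : ℕ) :
      ∫ ω, V n (W n i ω) ^ r ∂(P n) = ∫ x, V n x ^ r ∂(μ n) :=
    (hW n i).integral_comp ((hVm n).pow_const r).aestronglyMeasurable
  have sum_integral_pow (n r : ℕ) :
      ∑ i, ∫ ω, V n (W n i ω) ^ r ∂(P n) = n * ∫ x, V n x ^ r ∂(μ n) := by
    simp only [integral_pow, Finset.sum_const, Finset.card_univ, Fintype.card_fin, nsmul_eq_mul]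
  refine ⟨fun n i => (hVm n).comp_aemeasurable (hW n i).aemeasurable,
    fun n => (hindep n).comp _ fun _ => hVm n, hV.mono fun n h4 i => ?_,
    Eventually.of_forall fun n i => by simpa [hmean] using integral_pow n i 1, ?_, ?_⟩
  · rw [← (hW n i).map_eq] at h4
    exact h4.comp_of_map (hW n i).aemeasurable
  · filter_upwards [hpos, eventually_gt_atTop 0] with n hn hn₀
    rw [sum_integral_pow]
    positivity
  · refine hratio.congr fun n => ?_
    rw [sum_integral_pow, sum_integral_pow]
    rcases eq_or_ne (n : ℝ) 0 with hn | hn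
    · simp only [hn, zero_mul, div_zero, zero_div]
    · field_simp

end OfHasLaw

lemma aemeasurable_sum (hY : IsLyapunovArray Y P) (n : ℕ) :
    AEMeasurable (fun ω => ∑ i, Y n i ω) (P n) :=
  Finset.aemeasurable_fun_sum _ fun i _ => hY.aemeasurable n i

lemma aemeasurable_sum_sq (hY : IsLyapunovArray Y P) (n : ℕ) :
    AEMeasurable (fun ω => ∑ i, Y n i ω ^ 2) (P n) :=
  Finset.aemeasurable_fun_sum _ fun i _ => (hY.aemeasurable n i).pow_const 2

variable [∀ n, IsProbabilityMeasure (P n)]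

lemma tendsto_charFun (hY : IsLyapunovArray Y P) (t : ℝ) :
    Tendsto (fun n => charFun ((P n).map fun ω => ∑ i, Y n i ω)
      ((√(∑ i, ∫ ω, Y n i ω ^ 2 ∂(P n)))⁻¹ * t)) atTop (𝓝 (Real.exp (-(t ^ 2 / 2)))) := by
  rw [tendsto_iff_norm_sub_tendsto_zero]
  have bound_tendsto := ((hY.tendsto_ratio.sqrt).const_mul (4 * |t| ^ 3)).add
    (hY.tendsto_ratio.const_mul (t ^ 4 / 8))
  simp only [Real.sqrt_zero, mul_zero, add_zero] at bound_tendsto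
  refine squeeze_zero' (Eventually.of_forall fun n => norm_nonneg _) ?_ bound_tendsto
  filter_upwards [hY.memLp, hY.integral_eq_zero, hY.sum_sq_pos] with n h4 hmean hpos
  exact norm_charFun_map_sum_normalized_sub_exp_le h4 hmean (hY.iIndepFun n) hpos t

theorem tendstoInDistribution (hY : IsLyapunovArray Y P) :
    TendstoInDistribution
      (fun n ω => (√(∑ i, ∫ ω, Y n i ω ^ 2 ∂(P n)))⁻¹ * ∑ i, Y n i ω) atTop (id : ℝ → ℝ) P
      (gaussianReal 0 1) := by
  refine ⟨fun n => (hY.aemeasurable_sum n).const_mul _, aemeasurable_id, ?_⟩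
  refine ProbabilityMeasure.tendsto_iff_tendsto_charFun.2 fun t => ?_
  have charFun_gaussian : charFun ((gaussianReal 0 1).map (id : ℝ → ℝ)) t
      = Real.exp (-(t ^ 2 / 2)) := by
    rw [Measure.map_id, charFun_gaussianReal]
    simp
  simp only [ProbabilityMeasure.coe_mk, charFun_gaussian]
  refine (hY.tendsto_charFun t).congr fun n => ?_
  rw [charFun_map_mul_comp (hY.aemeasurable_sum n)]

lemma tendstoInProbability_sum_sq (hY : IsLyapunovArray Y P) :
    TendstoInProbability
      (fun n ω => (∑ i, Y n i ω ^ 2) / ∑ i, ∫ ω, Y n i ω ^ 2 ∂(P n)) atTop 1 P := by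
  intro ε hε
  have lim : Tendsto (fun n => ENNReal.ofReal ((∑ i, ∫ ω, Y n i ω ^ 4 ∂(P n)) /
      (∑ i, ∫ ω, Y n i ω ^ 2 ∂(P n)) ^ 2 / ε ^ 2)) atTop (𝓝 0) := by
    simpa using ENNReal.tendsto_ofReal (hY.tendsto_ratio.div_const (ε ^ 2))
  refine tendsto_of_tendsto_of_tendsto_of_le_of_le' tendsto_const_nhds lim
    (Eventually.of_forall fun n => zero_le) ?_
  filter_upwards [hY.memLp, hY.sum_sq_pos] with n h4 hpos
  exact measure_le_dist_sum_sq_div_le h4 (fun _ _ hik => (hY.iIndepFun n).indepFun hik) hpos hε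

theorem tendstoInDistribution_self_normalized (hY : IsLyapunovArray Y P) :
    TendstoInDistribution (fun n ω => (∑ i, Y n i ω) / √(∑ i, Y n i ω ^ 2)) atTop (id : ℝ → ℝ) P
      (gaussianReal 0 1) := by
  have aemeasurable_norm (n : ℕ) : AEMeasurable (fun ω => (√((∑ i, Y n i ω ^ 2) /
      ∑ i, ∫ ω, Y n i ω ^ 2 ∂(P n)))⁻¹) (P n) :=
    ((hY.aemeasurable_sum_sq n).div_const _).sqrt.inv
  have norm_tendsto : TendstoInProbability (fun n ω => (√((∑ i, Y n i ω ^ 2) /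
      ∑ i, ∫ ω, Y n i ω ^ 2 ∂(P n)))⁻¹) atTop 1 P := by
    have hc : ContinuousAt (fun y : ℝ => (√y)⁻¹) 1 :=
      Real.continuous_sqrt.continuousAt.inv₀ (by simp)
    simpa using hY.tendstoInProbability_sum_sq.comp_continuousAt hc
  have slutsky := tendstoInDistribution_mul_of_tendstoInProbability_one hY.tendstoInDistribution
    aemeasurable_norm norm_tendsto
  refine tendstoInDistribution_congr_eventually slutsky
    (fun n => (hY.aemeasurable_sum n).div (hY.aemeasurable_sum_sq n).sqrt) ?_
  filter_upwards [hY.sum_sq_pos] with n hpos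
  refine ae_of_all _ fun ω => ?_
  have := Real.sqrt_pos.2 hpos
  simp only [Real.sqrt_div' _ hpos.le]
  field_simp

end IsLyapunovArray

end LyapunovArray

section Quantile

variable (μ : Measure ℝ)

lemma bddBelow_le_cdf {p : ℝ} (hp : 0 < p) : BddBelow {x : ℝ | p ≤ cdf μ x} := by
  obtain ⟨b, hb⟩ := ((tendsto_cdf_atBot μ).eventually_lt_const hp).exists
  refine ⟨b, fun x hx => ?_⟩
  by_contra h
  exact absurd (hx.trans (monotone_cdf μ (not_le.1 h).le)) (not_le.2 hb)

lemma nonempty_le_cdf {p : ℝ} (hp : p < 1) : {x : ℝ | p ≤ cdf μ x}.Nonempty := by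
  obtain ⟨b, hb⟩ := ((tendsto_cdf_atTop μ).eventually_const_lt hp).exists
  exact ⟨b, hb.le⟩

lemma monotoneOn_quantile : MonotoneOn (quantile μ) (Set.Ioo 0 1) := fun _ hp _ hq hpq =>
  csInf_le_csInf (bddBelow_le_cdf μ hp.1) (nonempty_le_cdf μ hq.2) fun _ hx => hpq.trans hx

lemma quantile_of_nonpos {p : ℝ} (hp : p ≤ 0) : quantile μ p = 0 := by
  have : {x : ℝ | p ≤ cdf μ x} = Set.univ :=
    Set.eq_univ_of_forall fun x => hp.trans (cdf_nonneg μ x)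
  rw [quantile, this, Real.sInf_univ]

lemma quantile_of_one_lt {p : ℝ} (hp : 1 < p) : quantile μ p = 0 := by
  have : {x : ℝ | p ≤ cdf μ x} = ∅ :=
    Set.eq_empty_of_forall_notMem fun x hx => absurd (hx.trans (cdf_le_one μ x)) (not_le.2 hp)
  rw [quantile, this, Real.sInf_empty]

-- Off `(0, 1)` only the endpoint `1` can have a nonzero value: the infimum is junk at every other
-- point.
lemma measurable_quantile : Measurable (quantile μ) := by
  refine measurable_of_restrict_of_restrict_compl (measurableSet_Ioo (a := (0 : ℝ)) (b := 1)) ?_ ?_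
  · have : Monotone ((Set.Ioo (0 : ℝ) 1).domRestrict (quantile μ)) := fun x y hxy =>
      monotoneOn_quantile μ x.2 y.2 hxy
    exact this.measurable
  · have : (Set.Ioo (0 : ℝ) 1)ᶜ.domRestrict (quantile μ)
        = fun p : ((Set.Ioo (0 : ℝ) 1)ᶜ : Set ℝ) => if (p : ℝ) = 1 then quantile μ 1 else 0 := by
      funext ⟨p, hp⟩
      rcases lt_trichotomy p 1 with h1 | rfl | h1
      · simp [h1.ne, quantile_of_nonpos μ (not_lt.1 fun h0 => hp ⟨h0, h1⟩)]
      · simp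
      · simp [h1.ne', quantile_of_one_lt μ h1]
    rw [this]
    exact Measurable.ite (measurable_subtype_coe (measurableSet_singleton (1 : ℝ)))
      measurable_const measurable_const

variable {μ}

lemma cdf_quantile (hc : Continuous (cdf μ)) {p : ℝ} (hp : p ∈ Set.Ioo (0 : ℝ) 1) :
    cdf μ (quantile μ p) = p := by
  have hcl : IsClosed {x : ℝ | p ≤ cdf μ x} := isClosed_le continuous_const hc
  refine le_antisymm ?_ (hcl.csInf_mem (nonempty_le_cdf μ hp.2) (bddBelow_le_cdf μ hp.1))
  obtain ⟨a, ha⟩ := ((tendsto_cdf_atBot μ).eventually_lt_const hp.1).exists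
  obtain ⟨b, hb⟩ := ((tendsto_cdf_atTop μ).eventually_const_lt hp.2).exists
  obtain ⟨x, hx⟩ := mem_range_of_exists_le_of_exists_ge hc ⟨a, ha.le⟩ ⟨b, hb.le⟩
  calc cdf μ (quantile μ p) ≤ cdf μ x :=
        monotone_cdf μ (csInf_le (bddBelow_le_cdf μ hp.1) hx.ge)
    _ = p := hx

end Quantile

lemma integrable_pow_of_memLp_top {Ω : Type*} [MeasurableSpace Ω] {P : Measure Ω}
    [IsFiniteMeasure P] {f : Ω → ℝ} (hf : MemLp f ∞ P) (r : ℕ) :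
    Integrable (fun ω => f ω ^ r) P := by
  refine (integrable_norm_iff (hf.aestronglyMeasurable.pow r)).1 ?_
  simpa only [Pi.pow_apply, norm_pow] using
    (hf.mono_exponent le_top : MemLp f r P).integrable_norm_pow'

namespace ThresholdModel

variable {d : ℕ} (M : ThresholdModel d)

/-- The product `U_j U_A` as a function of `p = (Z, θ)`: the summand of `ψ̂_n(j,A)`. -/
noncomputable def UProd (j : Fin d) (A : Finset (Fin d)) (p : (Fin d → ℝ) × (Fin d → ℝ)) : ℝ :=
  M.U p.1 p.2 j * M.UAvg p.1 p.2 A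

/-- The latent variable `Z_j` is independent of `(Z_k)_{k ∈ A}`: assumption (i). -/
abbrev LatentIndep (j : Fin d) (A : Finset (Fin d)) : Prop :=
  IndepFun (fun z : Fin d → ℝ => z j) (fun (z : Fin d → ℝ) (k : A) => z k) M.φ

lemma measurable_X (k : Fin d) :
    Measurable fun p : (Fin d → ℝ) × (Fin d → ℝ) => M.X p.1 p.2 k := by
  unfold X
  refine Measurable.ite (measurableSet_le (by fun_prop) ?_) measurable_const measurable_const
  exact (measurable_quantile _).comp (by fun_prop)

lemma measurable_U (k : Fin d) :
    Measurable fun p : (Fin d → ℝ) × (Fin d → ℝ) => M.U p.1 p.2 k := by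
  have := M.measurable_X k
  unfold U
  fun_prop

lemma measurable_UAvg (A : Finset (Fin d)) :
    Measurable fun p : (Fin d → ℝ) × (Fin d → ℝ) => M.UAvg p.1 p.2 A := by
  have := M.measurable_U
  unfold UAvg
  fun_prop

lemma measurable_UProd (j : Fin d) (A : Finset (Fin d)) : Measurable (M.UProd j A) :=
  (M.measurable_U j).mul (M.measurable_UAvg A)

section FixedThreshold

lemma memLp_top_U_left (t : Fin d → ℝ) (k : Fin d) : MemLp (fun z => M.U z t k) ∞ M.φ := by
  refine MemLp.of_bound ((M.measurable_U k).comp measurable_prodMk_right).aestronglyMeasurable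
    (max |(0 - t k) / √(t k * (1 - t k))| |(1 - t k) / √(t k * (1 - t k))|)
    (ae_of_all _ fun z => ?_)
  unfold U X
  split_ifs
  · exact le_max_right _ _
  · exact le_max_left _ _

lemma memLp_top_UAvg_left (t : Fin d → ℝ) (A : Finset (Fin d)) :
    MemLp (fun z => M.UAvg z t A) ∞ M.φ :=
  (memLp_finsetSum _ fun k _ => M.memLp_top_U_left t k).const_mul _

lemma memLp_top_UProd_left (t : Fin d → ℝ) (j : Fin d) (A : Finset (Fin d)) :
    MemLp (fun z => M.UProd j A (z, t)) ∞ M.φ :=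
  (M.memLp_top_UAvg_left t A).mul' (M.memLp_top_U_left t j)

variable {t : Fin d → ℝ}

lemma measureReal_le_quantile {k : Fin d} (ht : t k ∈ Set.Ioo (0 : ℝ) 1) :
    M.φ.real {z | z k ≤ quantile (M.φ.map fun w => w k) (t k)} = t k := by
  have : IsProbabilityMeasure (M.φ.map fun w => w k) :=
    Measure.isProbabilityMeasure_map (measurable_pi_apply k).aemeasurable
  have h := cdf_quantile (M.continuous_cdf k) ht
  rwa [cdf_eq_real, map_measureReal_apply (by fun_prop) measurableSet_Iic] at h

lemma integral_comp_X {k : Fin d} (ht : t k ∈ Set.Ioo (0 : ℝ) 1) (g : ℝ → ℝ) :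
    ∫ z, g (M.X z t k) ∂M.φ = t k * g 1 + (1 - t k) * g 0 := by
  let S : Set (Fin d → ℝ) := {z | z k ≤ quantile (M.φ.map fun w => w k) (t k)}
  have hS : MeasurableSet S := measurableSet_le (by fun_prop) measurable_const
  have hgX (z : Fin d → ℝ) : g (M.X z t k) = g 0 + S.indicator (fun _ => g 1 - g 0) z := by
    classical
    rw [Set.indicator_apply]
    unfold X
    split_ifs with h₁ h₂ h₂
    · ring
    · exact absurd h₁ h₂
    · exact absurd h₂ h₁
    · ring
  simp only [hgX]
  rw [integral_add (integrable_const _) ((integrable_const _).indicator hS),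
    integral_indicator_const _ hS, M.measureReal_le_quantile ht, integral_const, probReal_univ,
    smul_eq_mul, smul_eq_mul]
  ring

lemma integral_U {k : Fin d} (ht : t k ∈ Set.Ioo (0 : ℝ) 1) : ∫ z, M.U z t k ∂M.φ = 0 := by
  unfold U
  rw [M.integral_comp_X ht fun x => (x - t k) / √(t k * (1 - t k))]
  ring

lemma integral_U_sq {k : Fin d} (ht : t k ∈ Set.Ioo (0 : ℝ) 1) :
    ∫ z, M.U z t k ^ 2 ∂M.φ = 1 := by
  unfold U
  rw [M.integral_comp_X ht fun x => ((x - t k) / √(t k * (1 - t k))) ^ 2]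
  have h0 : 0 < t k := ht.1
  have h1 : 0 < 1 - t k := sub_pos.2 ht.2
  simp only [div_pow]
  rw [Real.sq_sqrt (by positivity)]
  field_simp
  ring

lemma integral_U_pow_four_le {k : Fin d} (ht : t k ∈ Set.Ioo (0 : ℝ) 1) :
    ∫ z, M.U z t k ^ 4 ∂M.φ ≤ (t k)⁻¹ * (1 - t k)⁻¹ := by
  have h0 : 0 < t k := ht.1
  have h1 : 0 < 1 - t k := sub_pos.2 ht.2
  have sqrt_pow_four : √(t k * (1 - t k)) ^ 4 = (t k * (1 - t k)) ^ 2 := by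
    rw [show 4 = 2 * 2 from rfl, pow_mul, Real.sq_sqrt (by positivity)]
  have integral_eq : ∫ z, M.U z t k ^ 4 ∂M.φ
      = ((1 - t k) ^ 3 + t k ^ 3) * ((t k)⁻¹ * (1 - t k)⁻¹) := by
    unfold U
    rw [M.integral_comp_X ht fun x => ((x - t k) / √(t k * (1 - t k))) ^ 4]
    simp only [div_pow, sqrt_pow_four]
    field_simp
    ring
  rw [integral_eq]
  refine mul_le_of_le_one_left (by positivity) ?_
  nlinarith [mul_pos h0 h1]

lemma UAvg_pow_four_le (z t : Fin d → ℝ) {A : Finset (Fin d)} (hA : A.Nonempty) :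
    M.UAvg z t A ^ 4 ≤ (1 / (A.card : ℝ)) * ∑ k ∈ A, M.U z t k ^ 4 := by
  have hc : (A.card : ℝ) ≠ 0 := by exact_mod_cast hA.card_ne_zero
  have := Real.pow_arith_mean_le_arith_mean_pow_of_even A (fun _ => 1 / (A.card : ℝ))
    (fun k => M.U z t k) (fun _ _ => by positivity) (by simp [hc]) (n := 4) (by decide)
  simpa only [UAvg, Finset.mul_sum] using this

lemma integral_UAvg_pow_four_le (ht : ∀ k, t k ∈ Set.Ioo (0 : ℝ) 1) {A : Finset (Fin d)}
    (hA : A.Nonempty) :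
    ∫ z, M.UAvg z t A ^ 4 ∂M.φ ≤ (1 / (A.card : ℝ)) * ∑ k ∈ A, (t k)⁻¹ * (1 - t k)⁻¹ := by
  have hint (k : Fin d) : Integrable (fun z => M.U z t k ^ 4) M.φ :=
    integrable_pow_of_memLp_top (M.memLp_top_U_left t k) 4
  calc ∫ z, M.UAvg z t A ^ 4 ∂M.φ
      ≤ ∫ z, (1 / (A.card : ℝ)) * ∑ k ∈ A, M.U z t k ^ 4 ∂M.φ :=
        integral_mono (integrable_pow_of_memLp_top (M.memLp_top_UAvg_left t A) 4)
          ((integrable_finsetSum _ fun k _ => hint k).const_mul _)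
          fun z => M.UAvg_pow_four_le z t hA
    _ = (1 / (A.card : ℝ)) * ∑ k ∈ A, ∫ z, M.U z t k ^ 4 ∂M.φ := by
        rw [integral_const_mul, integral_finsetSum _ fun k _ => hint k]
    _ ≤ (1 / (A.card : ℝ)) * ∑ k ∈ A, (t k)⁻¹ * (1 - t k)⁻¹ := by
        gcongr with k _
        exact M.integral_U_pow_four_le (ht k)

variable {j : Fin d} {A : Finset (Fin d)}

lemma indepFun_U_UAvg (h : M.LatentIndep j A) (t : Fin d → ℝ) :
    IndepFun (fun z => M.U z t j) (fun z => M.UAvg z t A) M.φ := by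
  classical
  let u (k : Fin d) (x : ℝ) : ℝ :=
    ((if x ≤ quantile (M.φ.map fun w => w k) (t k) then 1 else 0) - t k) / √(t k * (1 - t k))
  have hu (k : Fin d) : Measurable (u k) :=
    ((Measurable.ite measurableSet_Iic measurable_const measurable_const).sub_const _).div_const _
  have hv : Measurable fun y : A → ℝ => (1 / (A.card : ℝ)) * ∑ k : A, u k (y k) :=
    (Finset.measurable_fun_sum _ fun (k : A) _ =>
      (hu k).fun_comp (measurable_pi_apply k)).const_mul _
  convert h.comp (hu j) hv using 1
  · funext z
    simp only [U, X, u, Function.comp]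
  · funext z
    simp only [UAvg, U, X, u, Function.comp]
    rw [← Finset.sum_coe_sort A]

lemma integral_UProd_left_pow (h : M.LatentIndep j A) (t : Fin d → ℝ) (r : ℕ) :
    ∫ z, M.UProd j A (z, t) ^ r ∂M.φ
      = (∫ z, M.U z t j ^ r ∂M.φ) * ∫ z, M.UAvg z t A ^ r ∂M.φ := by
  simp only [UProd, mul_pow]
  exact ((M.indepFun_U_UAvg h t).comp (φ := fun x : ℝ => x ^ r) (ψ := fun x : ℝ => x ^ r)
    (by fun_prop) (by fun_prop)).integral_fun_mul_eq_mul_integral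
    (integrable_pow_of_memLp_top (M.memLp_top_U_left t j) r).1
    (integrable_pow_of_memLp_top (M.memLp_top_UAvg_left t A) r).1

lemma integral_UProd_left_pow_four_le (ht : ∀ k, t k ∈ Set.Ioo (0 : ℝ) 1) (hA : A.Nonempty)
    (h : M.LatentIndep j A) :
    ∫ z, M.UProd j A (z, t) ^ 4 ∂M.φ
      ≤ (A.card : ℝ)⁻¹ * ∑ k ∈ A, (t j)⁻¹ * (t k)⁻¹ * (1 - t j)⁻¹ * (1 - t k)⁻¹ := by
  have h0 : 0 < t j := (ht j).1
  have h1 : 0 < 1 - t j := sub_pos.2 (ht j).2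
  calc ∫ z, M.UProd j A (z, t) ^ 4 ∂M.φ
      = (∫ z, M.U z t j ^ 4 ∂M.φ) * ∫ z, M.UAvg z t A ^ 4 ∂M.φ := M.integral_UProd_left_pow h t 4
    _ ≤ ((t j)⁻¹ * (1 - t j)⁻¹) * ((1 / (A.card : ℝ)) * ∑ k ∈ A, (t k)⁻¹ * (1 - t k)⁻¹) :=
        mul_le_mul (M.integral_U_pow_four_le (ht j)) (M.integral_UAvg_pow_four_le ht hA)
          (integral_nonneg fun z => by positivity) (by positivity)
    _ = (A.card : ℝ)⁻¹ * ∑ k ∈ A, (t j)⁻¹ * (t k)⁻¹ * (1 - t j)⁻¹ * (1 - t k)⁻¹ := by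
        rw [one_div, mul_left_comm, Finset.mul_sum]
        congr 1
        exact Finset.sum_congr rfl fun k _ => by ring

end FixedThreshold

section Moments

lemma memLp_U (k : Fin d) :
    MemLp (fun p : (Fin d → ℝ) × (Fin d → ℝ) => M.U p.1 p.2 k) 2 (M.φ.prod M.ν) := by
  have hm := M.measurable_U k
  refine (memLp_two_iff_integrable_sq hm.aestronglyMeasurable).2
    ((integrable_prod_iff' (hm.pow_const 2).aestronglyMeasurable).2
      ⟨ae_of_all _ fun t => integrable_pow_of_memLp_top (M.memLp_top_U_left t k) 2, ?_⟩)
  refine (integrable_const 1).congr ?_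
  filter_upwards [M.threshold_mem] with t ht
  simp only [norm_pow, Real.norm_eq_abs, sq_abs, M.integral_U_sq (ht k)]

lemma memLp_UAvg (A : Finset (Fin d)) :
    MemLp (fun p : (Fin d → ℝ) × (Fin d → ℝ) => M.UAvg p.1 p.2 A) 2 (M.φ.prod M.ν) :=
  (memLp_finsetSum _ fun k _ => M.memLp_U k).const_mul _

lemma psi_eq_integral (j k : Fin d) :
    M.psi j k = ∫ p : (Fin d → ℝ) × (Fin d → ℝ), M.U p.1 p.2 j * M.U p.1 p.2 k
      ∂(M.φ.prod M.ν) := by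
  refine integral_congr_ae ?_
  filter_upwards [Measure.quasiMeasurePreserving_snd.ae M.threshold_mem] with p hp
  have h0 : 0 < p.2 j := (hp j).1
  have h1 : 0 < 1 - p.2 j := sub_pos.2 (hp j).2
  simp only [U]
  rw [Real.sqrt_mul (by positivity), div_mul_div_comm]

lemma Psi_eq_integral (A : Finset (Fin d)) :
    M.Psi A = ∫ p : (Fin d → ℝ) × (Fin d → ℝ), M.UAvg p.1 p.2 A ^ 2 ∂(M.φ.prod M.ν) := by
  have hint (k l : Fin d) : Integrable (fun p : (Fin d → ℝ) × (Fin d → ℝ) =>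
      M.U p.1 p.2 k * M.U p.1 p.2 l) (M.φ.prod M.ν) :=
    (M.memLp_U k).integrable_mul (M.memLp_U l)
  have UAvg_sq (p : (Fin d → ℝ) × (Fin d → ℝ)) : M.UAvg p.1 p.2 A ^ 2
      = (1 / (A.card : ℝ) ^ 2) * ∑ k ∈ A, ∑ l ∈ A, M.U p.1 p.2 k * M.U p.1 p.2 l := by
    rw [UAvg, mul_pow, sq (∑ k ∈ A, _), Finset.sum_mul_sum, div_pow, one_pow]
  simp only [UAvg_sq, Psi, psi_eq_integral]
  rw [integral_const_mul, integral_finsetSum _ fun k _ => integrable_finsetSum _ fun l _ =>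
    hint k l]
  simp only [integral_finsetSum _ fun l _ => hint _ l]

variable {j : Fin d} {A : Finset (Fin d)}

lemma integral_UProd (h : M.LatentIndep j A) :
    ∫ p, M.UProd j A p ∂(M.φ.prod M.ν) = 0 := by
  have hint : Integrable (M.UProd j A) (M.φ.prod M.ν) :=
    (M.memLp_U j).integrable_mul (M.memLp_UAvg A)
  rw [integral_prod_symm _ hint]
  refine integral_eq_zero_of_ae ?_
  filter_upwards [M.threshold_mem] with t ht
  simpa [M.integral_U (ht j)] using M.integral_UProd_left_pow h t 1

lemma ae_integral_UProd_left_sq (h : M.LatentIndep j A) :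
    ∀ᵐ t ∂M.ν, ∫ z, M.UProd j A (z, t) ^ 2 ∂M.φ = ∫ z, M.UAvg z t A ^ 2 ∂M.φ := by
  filter_upwards [M.threshold_mem] with t ht
  rw [M.integral_UProd_left_pow h, M.integral_U_sq (ht j), one_mul]

lemma integrable_UProd_sq (h : M.LatentIndep j A) :
    Integrable (fun p => M.UProd j A p ^ 2) (M.φ.prod M.ν) := by
  refine (integrable_prod_iff' ((M.measurable_UProd j A).pow_const 2).aestronglyMeasurable).2
    ⟨ae_of_all _ fun t => integrable_pow_of_memLp_top (M.memLp_top_UProd_left t j A) 2, ?_⟩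
  refine (M.memLp_UAvg A).integrable_sq.integral_prod_right.congr ?_
  filter_upwards [M.ae_integral_UProd_left_sq h] with t ht
  simp only [norm_pow, Real.norm_eq_abs, sq_abs, ht]

lemma integral_UProd_sq (h : M.LatentIndep j A) :
    ∫ p, M.UProd j A p ^ 2 ∂(M.φ.prod M.ν) = M.Psi A := by
  rw [M.Psi_eq_integral, integral_prod_symm _ (M.integrable_UProd_sq h),
    integral_prod_symm _ (M.memLp_UAvg A).integrable_sq]
  exact integral_congr_ae (M.ae_integral_UProd_left_sq h)

lemma ofReal_integral_UProd_left_pow_four_le {t : Fin d → ℝ}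
    (ht : ∀ k, t k ∈ Set.Ioo (0 : ℝ) 1) (hA : A.Nonempty) (h : M.LatentIndep j A) :
    ENNReal.ofReal (∫ z, M.UProd j A (z, t) ^ 4 ∂M.φ)
      ≤ (A.card : ℝ≥0∞)⁻¹ *
        ∑ k ∈ A, ENNReal.ofReal ((t j)⁻¹ * (t k)⁻¹ * (1 - t j)⁻¹ * (1 - t k)⁻¹) := by
  have h0 (k : Fin d) : 0 < t k := (ht k).1
  have h1 (k : Fin d) : 0 < 1 - t k := sub_pos.2 (ht k).2
  have term_nonneg (k : Fin d) : 0 ≤ (t j)⁻¹ * (t k)⁻¹ * (1 - t j)⁻¹ * (1 - t k)⁻¹ := by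
    have := h0 j
    have := h0 k
    have := h1 j
    have := h1 k
    positivity
  have hc : 0 < (A.card : ℝ) := by exact_mod_cast hA.card_pos
  rw [← ENNReal.ofReal_sum_of_nonneg fun k _ => term_nonneg k, ← ENNReal.ofReal_natCast,
    ← ENNReal.ofReal_inv_of_pos hc, ← ENNReal.ofReal_mul (by positivity)]
  exact ENNReal.ofReal_le_ofReal (M.integral_UProd_left_pow_four_le ht hA h)

lemma lintegral_UProd_pow_four_le (hA : A.Nonempty) (h : M.LatentIndep j A) :
    ∫⁻ p, ENNReal.ofReal (M.UProd j A p ^ 4) ∂(M.φ.prod M.ν)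
      ≤ (A.card : ℝ≥0∞)⁻¹ * ∑ k ∈ A, M.thresholdMoment j k := by
  have hm (k : Fin d) : Measurable fun t : Fin d → ℝ =>
      ENNReal.ofReal ((t j)⁻¹ * (t k)⁻¹ * (1 - t j)⁻¹ * (1 - t k)⁻¹) := by fun_prop
  calc ∫⁻ p, ENNReal.ofReal (M.UProd j A p ^ 4) ∂(M.φ.prod M.ν)
      = ∫⁻ t, ∫⁻ z, ENNReal.ofReal (M.UProd j A (z, t) ^ 4) ∂M.φ ∂M.ν :=
        lintegral_prod_symm _ ((M.measurable_UProd j A).pow_const 4).ennreal_ofReal.aemeasurable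
    _ = ∫⁻ t, ENNReal.ofReal (∫ z, M.UProd j A (z, t) ^ 4 ∂M.φ) ∂M.ν :=
        lintegral_congr fun t => (ofReal_integral_eq_lintegral_ofReal
          (integrable_pow_of_memLp_top (M.memLp_top_UProd_left t j A) 4)
          (ae_of_all _ fun z => by positivity)).symm
    _ ≤ ∫⁻ t, (A.card : ℝ≥0∞)⁻¹ * ∑ k ∈ A,
          ENNReal.ofReal ((t j)⁻¹ * (t k)⁻¹ * (1 - t j)⁻¹ * (1 - t k)⁻¹) ∂M.ν :=
        lintegral_mono_ae (M.threshold_mem.mono fun t ht =>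
          M.ofReal_integral_UProd_left_pow_four_le ht hA h)
    _ = (A.card : ℝ≥0∞)⁻¹ * ∑ k ∈ A, M.thresholdMoment j k := by
        rw [lintegral_const_mul _ (Finset.measurable_fun_sum _ fun k _ => hm k),
          lintegral_finsetSum _ fun k _ => hm k]
        rfl

lemma thresholdMoment_ne_zero (j k : Fin d) : M.thresholdMoment j k ≠ 0 := by
  unfold thresholdMoment
  rw [Ne, lintegral_eq_zero_iff (by fun_prop)]
  intro h
  obtain ⟨t, hzero, ht⟩ := (h.and M.threshold_mem).exists
  have hj₀ : 0 < t j := (ht j).1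
  have hk₀ : 0 < t k := (ht k).1
  have hj₁ : 0 < 1 - t j := sub_pos.2 (ht j).2
  have hk₁ : 0 < 1 - t k := sub_pos.2 (ht k).2
  have hpos : 0 < (t j)⁻¹ * (t k)⁻¹ * (1 - t j)⁻¹ * (1 - t k)⁻¹ := by positivity
  exact (ENNReal.ofReal_pos.2 hpos).ne' hzero

lemma Psi_pos_of_momentRatio_ne_top (hA : A.Nonempty) (hR : M.momentRatio j A ≠ ∞) :
    0 < M.Psi A := by
  by_contra hneg
  obtain ⟨k, hk⟩ := hA
  have sum_ne_zero : ∑ k ∈ A, M.thresholdMoment j k ≠ 0 := fun h0 =>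
    M.thresholdMoment_ne_zero j k (Finset.sum_eq_zero_iff.1 h0 k hk)
  refine hR ?_
  rw [momentRatio, ENNReal.ofReal_of_nonpos (not_lt.1 hneg), zero_pow two_ne_zero,
    ENNReal.inv_zero, ENNReal.top_mul]
  exact mul_ne_zero (by simp) sum_ne_zero

lemma mean_thresholdMoment_ne_top (hR : M.momentRatio j A ≠ ∞) :
    (A.card : ℝ≥0∞)⁻¹ * ∑ k ∈ A, M.thresholdMoment j k ≠ ∞ := fun htop => by
  refine hR ?_
  rw [momentRatio, htop, ENNReal.mul_top (ENNReal.inv_ne_zero.2 (by simp))]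

lemma integrable_UProd_pow_four (hA : A.Nonempty) (h : M.LatentIndep j A)
    (hR : M.momentRatio j A ≠ ∞) :
    Integrable (fun p => M.UProd j A p ^ 4) (M.φ.prod M.ν) := by
  refine ⟨((M.measurable_UProd j A).pow_const 4).aestronglyMeasurable, ?_⟩
  rw [hasFiniteIntegral_iff_ofReal (ae_of_all _ fun p => by positivity)]
  exact (M.lintegral_UProd_pow_four_le hA h).trans_lt (M.mean_thresholdMoment_ne_top hR).lt_top

lemma memLp_UProd (hA : A.Nonempty) (h : M.LatentIndep j A) (hR : M.momentRatio j A ≠ ∞) :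
    MemLp (M.UProd j A) 4 (M.φ.prod M.ν) := by
  refine (integrable_norm_rpow_iff (M.measurable_UProd j A).aestronglyMeasurable
    (by norm_num) (by norm_num)).1 ?_
  simpa [(by decide : Even 4).pow_abs] using M.integrable_UProd_pow_four hA h hR

lemma ofReal_integral_UProd_pow_four_div_le (hA : A.Nonempty) (h : M.LatentIndep j A)
    (hR : M.momentRatio j A ≠ ∞) :
    ENNReal.ofReal ((∫ p, M.UProd j A p ^ 4 ∂(M.φ.prod M.ν)) / M.Psi A ^ 2)
      ≤ M.momentRatio j A := by
  have hΨ := M.Psi_pos_of_momentRatio_ne_top hA hR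
  rw [ENNReal.ofReal_div_of_pos (by positivity), ENNReal.ofReal_pow hΨ.le,
    ofReal_integral_eq_lintegral_ofReal (M.integrable_UProd_pow_four hA h hR)
      (ae_of_all _ fun p => by positivity), momentRatio, ENNReal.div_eq_inv_mul]
  gcongr
  exact M.lintegral_UProd_pow_four_le hA h

end Moments

end ThresholdModel

section Pairs

variable {Ω ι E : Type*} [MeasurableSpace Ω] [MeasurableSpace E] {P : Measure Ω}
  [IsProbabilityMeasure P] {Z θ : ι → Ω → E}

lemma hasLaw_prodMk_of_sumElim {φ ν : Measure E} (hZ : ∀ i, HasLaw (Z i) φ P)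
    (hθ : ∀ i, HasLaw (θ i) ν P) (h : iIndepFun (Sum.elim Z θ) P) (i : ι) :
    HasLaw (fun ω => (Z i ω, θ i ω)) (φ.prod ν) P := by
  have hi : IndepFun (Z i) (θ i) P :=
    h.indepFun (i := Sum.inl i) (j := Sum.inr i) (by simp)
  exact hi.hasLaw_prod (hZ i) (hθ i)

lemma iIndepFun_prodMk_of_sumElim [Finite ι] (hZ : ∀ i, AEMeasurable (Z i) P)
    (hθ : ∀ i, AEMeasurable (θ i) P) (h : iIndepFun (Sum.elim Z θ) P) :
    iIndepFun (fun i ω => (Z i ω, θ i ω)) P := by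
  cases nonempty_fintype ι
  have hm (s : ι ⊕ ι) : AEMeasurable (Sum.elim Z θ s) P := by
    rcases s with i | i
    exacts [hZ i, hθ i]
  let ρ (s : ι ⊕ ι) : Measure E := P.map (Sum.elim Z θ s)
  have (s : ι ⊕ ι) : IsProbabilityMeasure (ρ s) := Measure.isProbabilityMeasure_map (hm s)
  have joint_law : HasLaw (fun ω s => Sum.elim Z θ s ω) (Measure.pi ρ) P :=
    h.hasLaw_pi fun s => ⟨hm s, rfl⟩
  have regroup : MeasurePreserving (fun (f : ι ⊕ ι → E) i => (f (Sum.inl i), f (Sum.inr i)))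
      (Measure.pi ρ) (Measure.pi fun i => (ρ (Sum.inl i)).prod (ρ (Sum.inr i))) :=
    (measurePreserving_arrowProdEquivProdArrow E E ι (fun i => ρ (Sum.inl i))
      fun i => ρ (Sum.inr i)).symm.comp (measurePreserving_sumPiEquivProdPi ρ)
  have pair_law (i : ι) :
      HasLaw (fun ω => (Z i ω, θ i ω)) ((ρ (Sum.inl i)).prod (ρ (Sum.inr i))) P :=
    (h.indepFun (i := Sum.inl i) (j := Sum.inr i) (by simp)).hasLaw_prod
      ⟨hZ i, rfl⟩ ⟨hθ i, rfl⟩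
  exact (iIndepFun_iff_hasLaw_pi_pi pair_law).2 (regroup.fun_comp_hasLaw joint_law)

end Pairs

namespace ThresholdModel

lemma sqrt_mul_psiHat_div_sigmaHat {d : ℕ} (M : ThresholdModel d) {n : ℕ}
    (z t : Fin n → Fin d → ℝ) (j : Fin d) (A : Finset (Fin d)) :
    √(n : ℝ) * (M.psiHat z t j A / M.sigmaHat z t j A)
      = (∑ i, M.UProd j A (z i, t i)) / √(∑ i, M.UProd j A (z i, t i) ^ 2) := by
  rcases Nat.eq_zero_or_pos n with rfl | hn
  · simp
  have : 0 < √(n : ℝ) := Real.sqrt_pos.2 (by exact_mod_cast hn)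
  have sqrt_mul_inv : √(n : ℝ) * (1 / (n : ℝ)) = 1 / √(n : ℝ) := by
    rw [mul_one_div, Real.sqrt_div_self']
  simp only [psiHat, sigmaHat, sigmaHatSq, UProd, mul_pow]
  rw [Real.sqrt_mul (by positivity), Real.sqrt_div zero_le_one, Real.sqrt_one, ← mul_div_assoc,
    ← mul_assoc, sqrt_mul_inv, mul_div_mul_left _ _ (by positivity)]

variable {d : ℕ → ℕ} {M : ∀ n, ThresholdModel (d n)} {j : ∀ n, Fin (d n)}
  {A : ∀ n, Finset (Fin (d n))}

lemma eventually_momentRatio_ne_top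
    (hii : Tendsto (fun n : ℕ => (M n).momentRatio (j n) (A n) / (n : ℝ≥0∞)) atTop (𝓝 0)) :
    ∀ᶠ n in atTop, (M n).momentRatio (j n) (A n) ≠ ∞ := by
  filter_upwards [hii.eventually_lt_const ENNReal.zero_lt_top] with n hlt htop
  rw [htop, ENNReal.top_div_of_ne_top (ENNReal.natCast_ne_top n)] at hlt
  exact lt_irrefl _ hlt

lemma tendsto_integral_UProd_pow_four_div (hA : ∀ n, (A n).Nonempty)
    (hi : ∀ n, (M n).LatentIndep (j n) (A n))
    (hii : Tendsto (fun n : ℕ => (M n).momentRatio (j n) (A n) / (n : ℝ≥0∞)) atTop (𝓝 0)) :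
    Tendsto (fun n : ℕ => (∫ p, (M n).UProd (j n) (A n) p ^ 4 ∂((M n).φ.prod (M n).ν)) /
      (M n).Psi (A n) ^ 2 / n) atTop (𝓝 0) := by
  have lim : Tendsto (fun n : ℕ => ENNReal.ofReal
      ((∫ p, (M n).UProd (j n) (A n) p ^ 4 ∂((M n).φ.prod (M n).ν)) /
        (M n).Psi (A n) ^ 2 / n)) atTop (𝓝 0) := by
    refine tendsto_of_tendsto_of_tendsto_of_le_of_le' tendsto_const_nhds hii
      (Eventually.of_forall fun n => zero_le) ?_
    filter_upwards [eventually_momentRatio_ne_top hii, eventually_gt_atTop 0] with n hR hn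
    rw [ENNReal.ofReal_div_of_pos (by exact_mod_cast hn), ENNReal.ofReal_natCast]
    gcongr
    exact (M n).ofReal_integral_UProd_pow_four_div_le (hA n) (hi n) hR
  refine ((ENNReal.tendsto_toReal ENNReal.zero_ne_top).comp lim).congr fun n => ?_
  exact ENNReal.toReal_ofReal (by positivity)

theorem isLyapunovArray_UProd {Ω : ℕ → Type*} [∀ n, MeasurableSpace (Ω n)]
    {P : ∀ n, Measure (Ω n)} [∀ n, IsProbabilityMeasure (P n)]
    {Z θ : ∀ n, Fin n → Ω n → Fin (d n) → ℝ} (hZ : ∀ n i, HasLaw (Z n i) (M n).φ (P n))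
    (hθ : ∀ n i, HasLaw (θ n i) (M n).ν (P n))
    (hindep : ∀ n, iIndepFun (Sum.elim (Z n) (θ n)) (P n))
    (hA : ∀ n, (A n).Nonempty) (hi : ∀ n, (M n).LatentIndep (j n) (A n))
    (hii : Tendsto (fun n : ℕ => (M n).momentRatio (j n) (A n) / (n : ℝ≥0∞)) atTop (𝓝 0)) :
    IsLyapunovArray (fun n (i : Fin n) ω => (M n).UProd (j n) (A n) (Z n i ω, θ n i ω)) P := by
  have hR := eventually_momentRatio_ne_top hii
  refine IsLyapunovArray.of_hasLaw (μ := fun n => (M n).φ.prod (M n).ν)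
    (fun n => (M n).measurable_UProd (j n) (A n))
    (fun n => hasLaw_prodMk_of_sumElim (hZ n) (hθ n) (hindep n))
    (fun n => iIndepFun_prodMk_of_sumElim (fun i => (hZ n i).aemeasurable)
      (fun i => (hθ n i).aemeasurable) (hindep n))
    (hR.mono fun n => (M n).memLp_UProd (hA n) (hi n))
    (fun n => (M n).integral_UProd (hi n)) ?_ ?_
  · filter_upwards [hR] with n hn
    rw [(M n).integral_UProd_sq (hi n)]
    exact (M n).Psi_pos_of_momentRatio_ne_top (hA n) hn
  · simp only [fun n => (M n).integral_UProd_sq (hi n)]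
    exact tendsto_integral_UProd_pow_four_div hA hi hii

end ThresholdModel

theorem theorem1_general
    (d : ℕ → ℕ) (M : ∀ n, ThresholdModel (d n))
    {Ω : ℕ → Type*} [∀ n, MeasurableSpace (Ω n)]
    (P : ∀ n, Measure (Ω n)) [∀ n, IsProbabilityMeasure (P n)]
    (Z θ : ∀ n, Fin n → Ω n → Fin (d n) → ℝ)
    (hZ : ∀ n i, HasLaw (Z n i) (M n).φ (P n))
    (hθ : ∀ n i, HasLaw (θ n i) (M n).ν (P n))
    (hindep : ∀ n, iIndepFun (Sum.elim (Z n) (θ n)) (P n))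
    (j : ∀ n, Fin (d n)) (A : ∀ n, Finset (Fin (d n))) (hA : ∀ n, (A n).Nonempty)
    (hi : ∀ n, IndepFun (fun z : Fin (d n) → ℝ => z (j n))
      (fun (z : Fin (d n) → ℝ) (k : A n) => z k) (M n).φ)
    (hii : Tendsto (fun n : ℕ => (M n).momentRatio (j n) (A n) / (n : ℝ≥0∞)) atTop (𝓝 0)) :
    TendstoInDistribution
      (fun (n : ℕ) (ω : Ω n) =>
        √(n : ℝ) *
          ((M n).psiHat (fun i => Z n i ω) (fun i => θ n i ω) (j n) (A n) /
            (M n).sigmaHat (fun i => Z n i ω) (fun i => θ n i ω) (j n) (A n)))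
      atTop (id : ℝ → ℝ) P (gaussianReal 0 1) := by
  simp only [ThresholdModel.sqrt_mul_psiHat_div_sigmaHat]
  exact (ThresholdModel.isLyapunovArray_UProd hZ hθ hindep hA hi
    hii).tendstoInDistribution_self_normalized

theorem theorem1
    -- for each `n`, a threshold model `(φ_n, ν_n)` in dimension `d_n`
    (d : ℕ → ℕ) (M : ∀ n, ThresholdModel (d n))
    -- independent `Z_1, …, Z_n ∼ φ_n` and `θ_1, …, θ_n ∼ ν_n`
    {Ω : ℕ → Type*} [∀ n, MeasurableSpace (Ω n)]
    (P : ∀ n, Measure (Ω n)) [∀ n, IsProbabilityMeasure (P n)]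
    (Z θ : ∀ n, Fin n → Ω n → Fin (d n) → ℝ)
    (hZ : ∀ n i, HasLaw (Z n i) (M n).φ (P n))
    (hθ : ∀ n i, HasLaw (θ n i) (M n).ν (P n))
    (hindep : ∀ n, iIndepFun (Sum.elim (Z n) (θ n)) (P n))
    -- a fixed variable `j` and nonempty sets `A_n ⊆ [d_n] \ {j}`
    (j : ℕ) (hj : ∀ n, j < d n)
    (A : ∀ n, Finset (Fin (d n))) (hA : ∀ n, (A n).Nonempty)
    (hjA : ∀ n, (⟨j, hj n⟩ : Fin (d n)) ∉ A n)
    -- (i) `Z_j` is independent of `{Z_k : k ∈ A_n}` under `φ_n`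
    (hi : ∀ n, IndepFun (fun z : Fin (d n) → ℝ => z ⟨j, hj n⟩)
      (fun (z : Fin (d n) → ℝ) (k : A n) => z k) (M n).φ)
    -- (ii) the normalized moment quantity is `o(n)`
    (hii : Tendsto (fun n : ℕ => (M n).momentRatio ⟨j, hj n⟩ (A n) / (n : ℝ≥0∞)) atTop (𝓝 0)) :
    TendstoInDistribution
      (fun (n : ℕ) (ω : Ω n) =>
        √(n : ℝ) *
          ((M n).psiHat (fun i => Z n i ω) (fun i => θ n i ω) ⟨j, hj n⟩ (A n) /
            (M n).sigmaHat (fun i => Z n i ω) (fun i => θ n i ω) ⟨j, hj n⟩ (A n)))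
      atTop (id : ℝ → ℝ) P (gaussianReal 0 1) :=
  theorem1_general d M P Z θ hZ hθ hindep (fun n => ⟨j, hj n⟩) A hA hi hii
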